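/- Let $X$ be a real vector space with an asymmetric norm $q$, i.e. a function $q:X\to[0,\infty)$ such that $q(tx)=tq(x)$ for all $t\ge 0$ and $x\in X$, $q(x+y)\le q(x)+q(y)$ for all $x,y\in X$, and $q(x)=q(-x)=0$ if and only if $x=0$. Equip $X$ with the topology $\tau_q$ generated by the sets $B_q(x,\varepsilon)=\{y\in X: q(y-x)<\varepsilon\}$ with $x\in X$, $\varepsilon>0$; a set is $q$-compact if it is compact for $\tau_q$. Let $q^s(x)=\max\{q(x),q(-x)\}$, which is a norm on $X$, and let $\theta(0)=\{x\in X: q(x)=0\}$. Let $K$ be a nonempty $q$-compact convex subset of $X$ such that $K+\theta(0)$ is $q^s$-locally compact, i.e. locally compact as a subspace of $X$ with the topology of the norm $q^s$. Then $K$ has at least one extreme point, i.e. there is $x\in K$ such that $x=y=z$ whenever $y,z\in K$ and $x=\lambda y+(1-\lambda)z$ for some $\lambda\in(0,1)$. In particular, if $K$ is a nonempty $q$-compact convex subset of $X$ such that $K+\theta(0)$ has finite dimension (i.e. its affine hull is finite dimensional), then $K$ has at least one extreme point. -/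

import Mathlib

open scoped Pointwise

/-- An asymmetric norm on a real vector space `X`: a function `q : X → [0, ∞)` that is
positively homogeneous, subadditive, and satisfies `q x = 0 = q (-x)` if and only if `x = 0`. -/
structure AsymmetricNorm (X : Type*) [AddCommGroup X] [Module ℝ X] where
  /-- the underlying function -/
  toFun : X → ℝ
  nonneg' : ∀ x, 0 ≤ toFun x
  smul' : ∀ (t : ℝ) (x : X), 0 ≤ t → toFun (t • x) = t * toFun x
  add_le' : ∀ x y, toFun (x + y) ≤ toFun x + toFun y
  eq_zero_iff' : ∀ x, (toFun x = 0 ∧ toFun (-x) = 0) ↔ x = 0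

namespace AsymmetricNorm

variable {X : Type*} [AddCommGroup X] [Module ℝ X]

instance : CoeFun (AsymmetricNorm X) (fun _ => X → ℝ) := ⟨toFun⟩

/-- The asymmetric open ball `B_q(x, ε) = {y | q (y - x) < ε}`. -/
def ball (q : AsymmetricNorm X) (x : X) (ε : ℝ) : Set X := {y | q (y - x) < ε}

/-- The topology `τ_q`, generated by the open balls `B_q(x, ε)` with `x ∈ X` and `ε > 0`. -/
abbrev topology (q : AsymmetricNorm X) : TopologicalSpace X :=
  TopologicalSpace.generateFrom {U | ∃ (x : X) (ε : ℝ), 0 < ε ∧ U = q.ball x ε}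

/-- The symmetrized norm `q^s x = max (q x) (q (-x))`. It is again an asymmetric norm, so
`q.symmetrization.topology` is the topology `τ_{q^s}` generated by the `q^s`-balls. -/
def symmetrization (q : AsymmetricNorm X) : AsymmetricNorm X where
  toFun x := max (q x) (q (-x))
  nonneg' x := le_max_of_le_left (q.nonneg' x)
  smul' t x ht := by
    rw [← smul_neg, q.smul' t x ht, q.smul' t (-x) ht, mul_max_of_nonneg _ _ ht]
  add_le' x y := by
    refine max_le ?_ ?_
    · exact (q.add_le' x y).trans (add_le_add (le_max_left _ _) (le_max_left _ _))
    · rw [neg_add]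
      exact (q.add_le' (-x) (-y)).trans (add_le_add (le_max_right _ _) (le_max_right _ _))
  eq_zero_iff' x := by
    rw [← q.eq_zero_iff' x, neg_neg, max_comm (q (-x)) (q x), and_self]
    constructor
    · intro h
      exact ⟨le_antisymm (h ▸ le_max_left _ _) (q.nonneg' _),
        le_antisymm (h ▸ le_max_right _ _) (q.nonneg' _)⟩
    · rintro ⟨h₁, h₂⟩
      rw [h₁, h₂, max_self]

/-- The set `θ(0) = {x | q x = 0}`. -/
def thetaZero (q : AsymmetricNorm X) : Set X := {x | q x = 0}

/-- `A` is `q`-compact: compact in the topology `τ_q`. -/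
def IsQCompact (q : AsymmetricNorm X) (A : Set X) : Prop :=
  @IsCompact X q.topology A

/-- `A` is `q`-locally compact: locally compact as a subspace of `(X, τ_q)`. -/
def IsQLocallyCompact (q : AsymmetricNorm X) (A : Set X) : Prop :=
  @LocallyCompactSpace A (TopologicalSpace.induced Subtype.val q.topology)

end AsymmetricNorm

/-! Let C = K + θ(0), viewed in the normed space (X, q^s). The q-compactness of K makes C closed for
q^s, and it bounds q on C, so C contains no line. Klee's theorem then gives C an extreme point k +
w. This is the midpoint of k and k + 2w, both in C, so w = 0: the point lies in K and is extreme
there.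

For Klee's theorem, the recession cone of C is salient and meets balls in compact sets, so some
continuous functional f is positive on it off 0. The slice {f ≤ f x} of C then contains no half-line
and is compact. Hence f attains its minimum over C on a compact face; by Krein–Milman that face has
an extreme point, which is extreme in C. -/

section NormedSpace

/-! ### Locally compact closed convex sets in a normed space -/

variable {E : Type*} [NormedAddCommGroup E] [NormedSpace ℝ E]

/-- The directions of the half-lines with origin `x` contained in the convex set `C`. -/
def Convex.recessionCone {C : Set E} (hC : Convex ℝ C) (x : E) : ConvexCone ℝ E where
  carrier := {v | ∀ t : ℝ, 0 ≤ t → x + t • v ∈ C}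
  smul_mem' c hc v hv t ht := by
    rw [smul_smul]
    exact hv _ (by positivity)
  add_mem' u hu v hv t ht := by
    have h := hC (hu (2 * t) (by positivity)) (hv (2 * t) (by positivity))
      (show (0 : ℝ) ≤ 1 / 2 by norm_num) (show (0 : ℝ) ≤ 1 / 2 by norm_num) (by norm_num)
    convert h using 1
    module

theorem Convex.mem_recessionCone {C : Set E} (hC : Convex ℝ C) {x v : E} :
    v ∈ hC.recessionCone x ↔ ∀ t : ℝ, 0 ≤ t → x + t • v ∈ C := Iff.rfl

theorem Convex.isClosed_recessionCone {C : Set E} (hC : Convex ℝ C) (hCc : IsClosed C) (x : E) :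
    IsClosed (hC.recessionCone x : Set E) := by
  have : (hC.recessionCone x : Set E) = ⋂ t : ℝ, ⋂ _ : 0 ≤ t, (fun v => x + t • v) ⁻¹' C := by
    ext v
    simp [Convex.mem_recessionCone]
  rw [this]
  exact isClosed_iInter fun t => isClosed_iInter fun _ => hCc.preimage (by fun_prop)

/-- If one ball around a point of a closed convex set meets it in a compact set, all balls do. -/
theorem Convex.isCompact_inter_closedBall {C : Set E} (hC : Convex ℝ C) (hCc : IsClosed C)
    {x : E} (hx : x ∈ C) {r : ℝ} (hr : 0 < r) (hcpt : IsCompact (C ∩ Metric.closedBall x r))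
    (M : ℝ) : IsCompact (C ∩ Metric.closedBall x M) := by
  obtain ⟨c, hc, hMc⟩ : ∃ c : ℝ, 1 ≤ c ∧ M ≤ c * r :=
    ⟨max 1 (M / r), le_max_left _ _, by
      rw [← div_le_iff₀ hr]
      exact le_max_right _ _⟩
  have hc0 : 0 < c := by linarith
  refine (hcpt.image (f := fun y => x + c • (y - x)) (by fun_prop)).of_isClosed_subset
    (hCc.inter Metric.isClosed_closedBall) ?_
  rintro y ⟨hyC, hyM⟩
  -- Contracting towards x by c⁻¹ stays in C by convexity and lands in the ball of radius r.
  refine ⟨x + c⁻¹ • (y - x), ⟨?_, ?_⟩, ?_⟩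
  · exact hC.add_smul_sub_mem hx hyC ⟨by positivity, inv_le_one_of_one_le₀ hc⟩
  · rw [mem_closedBall_iff_norm] at hyM ⊢
    rw [add_sub_cancel_left, norm_smul, Real.norm_of_nonneg (by positivity), inv_mul_le_iff₀ hc0]
    exact hyM.trans hMc
  · simp [smul_smul, hc0.ne']

/-- A closed convex set that meets balls in compact sets and contains no half-line is compact. -/
theorem Convex.isCompact_of_recessionCone {C : Set E} (hC : Convex ℝ C) (hCc : IsClosed C)
    {x : E} (hx : x ∈ C) (hcpt : ∀ M, IsCompact (C ∩ Metric.closedBall x M))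
    (hrec : ∀ v ∈ hC.recessionCone x, v = 0) : IsCompact C := by
  by_contra hnc
  -- Unit directions along which C reaches distance n + 1 from x. These sets decrease, and their
  -- common element spans a half-line in C. The shift by 1 makes `T 0` compact already.
  let T : ℕ → Set E := fun n => {v | ‖v‖ = 1 ∧ x + ((n : ℝ) + 1) • v ∈ C}
  have hmono : ∀ (v : E) (s t : ℝ), 0 ≤ s → s ≤ t → x + t • v ∈ C → x + s • v ∈ C := by
    intro v s t hs hst h
    rcases hs.eq_or_lt with rfl | hs'
    · simpa using hx
    have ht : 0 < t := hs'.trans_le hst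
    have := hC.add_smul_sub_mem hx h (t := s / t)
      ⟨by positivity, (div_le_one ht).2 hst⟩
    rwa [add_sub_cancel_left, smul_smul, div_mul_cancel₀ _ ht.ne'] at this
  have hTc : ∀ n, IsClosed (T n) := fun n =>
    (isClosed_eq continuous_norm continuous_const).inter
      (hCc.preimage (f := fun v => x + ((n : ℝ) + 1) • v) (by fun_prop))
  have hT0 : IsCompact (T 0) := by
    refine ((hcpt 1).image (f := fun y => y - x) (by fun_prop)).of_isClosed_subset (hTc 0) ?_
    rintro v ⟨hv, hvC⟩
    exact ⟨x + v, ⟨by simpa using hvC, by simp [hv]⟩, by simp⟩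
  have hTn : ∀ n, (T n).Nonempty := by
    intro n
    by_contra hemp
    refine hnc ((hcpt (n + 1)).of_isClosed_subset hCc fun y hy => ⟨hy, ?_⟩)
    rw [mem_closedBall_iff_norm]
    by_contra! hlt
    have hpos : 0 < ‖y - x‖ := lt_trans (by positivity) hlt
    refine hemp ⟨‖y - x‖⁻¹ • (y - x), ?_, ?_⟩
    · rw [norm_smul, norm_inv, norm_norm, inv_mul_cancel₀ hpos.ne']
    · refine hmono _ _ ‖y - x‖ (by positivity) hlt.le ?_
      rw [smul_smul, mul_inv_cancel₀ hpos.ne', one_smul]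
      simpa using hy
  obtain ⟨v, hv⟩ := IsCompact.nonempty_iInter_of_sequence_nonempty_isCompact_isClosed T
    (fun n v hv => ⟨hv.1, hmono v _ _ (by positivity) (by push_cast; linarith) hv.2⟩) hTn hT0 hTc
  rw [Set.mem_iInter] at hv
  have hv0 : v = 0 := by
    refine hrec v fun t ht => ?_
    obtain ⟨n, hn⟩ := exists_nat_ge t
    exact hmono v t _ ht (by linarith) (hv n).2
  have := (hv 0).1
  simp [hv0] at this

/-- A closed salient convex cone that meets balls in compact sets admits a continuous linear
functional which is positive on its nonzero vectors. -/
theorem ConvexCone.Salient.exists_dual_pos {R : ConvexCone ℝ E} (hR : R.Salient)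
    (hcpt : ∀ M, IsCompact ((R : Set E) ∩ Metric.closedBall 0 M)) :
    ∃ f : StrongDual ℝ E, ∀ v ∈ R, v ≠ 0 → 0 < f v := by
  -- Separating 0 from a compact convex B containing the unit vectors of R yields f. B is the convex
  -- hull of finitely many small pieces of R.
  have key : ∃ B : Set E, IsCompact B ∧ Convex ℝ B ∧ B ⊆ R ∧ (0 : E) ∉ B ∧
      (R : Set E) ∩ Metric.sphere 0 1 ⊆ B := by
    have hS : IsCompact ((R : Set E) ∩ Metric.sphere 0 1) := by
      have := (hcpt 1).inter_right (Metric.isClosed_sphere (x := (0 : E)) (ε := 1))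
      rwa [Set.inter_assoc, Set.inter_eq_right.2 Metric.sphere_subset_closedBall] at this
    refine hS.induction_on (p := fun s => ∃ B : Set E, IsCompact B ∧ Convex ℝ B ∧ B ⊆ R ∧
      (0 : E) ∉ B ∧ s ⊆ B) ?_ ?_ ?_ ?_
    · exact ⟨∅, isCompact_empty, convex_empty, Set.empty_subset _, by simp, subset_rfl⟩
    · rintro s t hst ⟨B, h1, h2, h3, h4, h5⟩
      exact ⟨B, h1, h2, h3, h4, hst.trans h5⟩
    · rintro s t ⟨A, hA1, hA2, hA3, hA4, hA5⟩ ⟨B, hB1, hB2, hB3, hB4, hB5⟩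
      rcases A.eq_empty_or_nonempty with rfl | hA
      · exact ⟨B, hB1, hB2, hB3, hB4, Set.union_subset (hA5.trans (Set.empty_subset _)) hB5⟩
      rcases B.eq_empty_or_nonempty with rfl | hB
      · exact ⟨A, hA1, hA2, hA3, hA4, Set.union_subset hA5 (hB5.trans (Set.empty_subset _))⟩
      have hjoin := hA2.convexHull_union hB2 hA hB
      refine ⟨convexHull ℝ (A ∪ B), ?_, convex_convexHull _ _,
        convexHull_min (Set.union_subset hA3 hB3) R.convex, ?_,
        (Set.union_subset_union hA5 hB5).trans (subset_convexHull _ _)⟩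
      · rw [hjoin]
        convert ((hA1.prod hB1).prod (isCompact_Icc (a := (0 : ℝ)) (b := 1))).image
          (f := fun z : (E × E) × ℝ => z.1.1 + z.2 • (z.1.2 - z.1.1)) (by fun_prop) using 1
        ext z
        simp only [mem_convexJoin, segment_eq_image', Set.mem_image, Set.mem_prod, Prod.exists]
        constructor
        · rintro ⟨a, ha, b, hb, t, ht, rfl⟩
          exact ⟨a, b, t, ⟨⟨ha, hb⟩, ht⟩, rfl⟩
        · rintro ⟨a, b, t, ⟨⟨ha, hb⟩, ht⟩, rfl⟩
          exact ⟨a, ha, b, hb, t, ht, rfl⟩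
      · rw [hjoin, mem_convexJoin]
        rintro ⟨a, ha, b, hb, α, β, hα, hβ, hαβ, h0⟩
        have ha0 : a ≠ 0 := fun h => hA4 (h ▸ ha)
        have hb0 : b ≠ 0 := fun h => hB4 (h ▸ hb)
        rcases hα.eq_or_lt with rfl | hα
        · have : β = 1 := by linarith
          subst this
          simp [hb0] at h0
        rcases hβ.eq_or_lt with rfl | hβ
        · have : α = 1 := by linarith
          subst this
          simp [ha0] at h0
        -- If 0 = αa + βb, then αa and its opposite βb are both in R, against salience.
        refine hR _ (R.smul_mem hα (hA3 ha)) (smul_ne_zero hα.ne' ha0) ?_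
        rw [neg_eq_of_add_eq_zero_right h0]
        exact R.smul_mem hβ (hB3 hb)
    · rintro x ⟨hxR, hx⟩
      rw [mem_sphere_zero_iff_norm] at hx
      have hRx : (R : Set E) ∩ Metric.closedBall x (1 / 2) =
          (R : Set E) ∩ Metric.closedBall 0 2 ∩ Metric.closedBall x (1 / 2) := by
        have hsub : Metric.closedBall x (1 / 2) ⊆ Metric.closedBall 0 2 := by
          refine Metric.closedBall_subset_closedBall' ?_
          rw [dist_zero_right, hx]
          norm_num
        rw [Set.inter_assoc, Set.inter_eq_right.2 hsub]
      -- Radius 1/2 < ‖x‖ = 1 keeps 0 out of the piece.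
      refine ⟨R ∩ Metric.sphere 0 1 ∩ Metric.ball x (1 / 2), Filter.inter_mem
        self_mem_nhdsWithin (mem_nhdsWithin_of_mem_nhds (Metric.ball_mem_nhds x (by norm_num))),
        R ∩ Metric.closedBall x (1 / 2), ?_, R.convex.inter (convex_closedBall _ _),
        Set.inter_subset_left, ?_, fun y hy => ⟨hy.1.1, Metric.ball_subset_closedBall hy.2⟩⟩
      · rw [hRx]
        exact (hcpt 2).inter_right Metric.isClosed_closedBall
      · rintro ⟨-, h⟩
        rw [mem_closedBall_iff_norm, zero_sub, norm_neg, hx] at h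
        norm_num at h
  obtain ⟨B, hBcpt, hBconv, -, hB0, hSB⟩ := key
  obtain ⟨f, u, hu, hf⟩ := geometric_hahn_banach_point_closed hBconv hBcpt.isClosed hB0
  rw [map_zero] at hu
  refine ⟨f, fun v hv hv0 => ?_⟩
  have hn : 0 < ‖v‖⁻¹ := inv_pos.2 (norm_pos_iff.2 hv0)
  have := hu.trans (hf (‖v‖⁻¹ • v) (hSB ⟨R.smul_mem hn hv, by
    simp [norm_smul, norm_ne_zero_iff.2 hv0]⟩))
  rw [map_smul, smul_eq_mul] at this
  exact (mul_pos_iff_of_pos_left hn).1 this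

/-- **Klee's theorem**: a nonempty closed convex set in a normed space which is locally compact
and contains no line has an extreme point. -/
theorem Convex.extremePoints_nonempty_of_no_line {C : Set E} (hC : Convex ℝ C)
    (hCc : IsClosed C) {x : E} (hx : x ∈ C) {r : ℝ} (hr : 0 < r)
    (hcpt : IsCompact (C ∩ Metric.closedBall x r))
    (hline : ∀ v : E, (∀ t : ℝ, x + t • v ∈ C) → v = 0) :
    (C.extremePoints ℝ).Nonempty := by
  have hball := hC.isCompact_inter_closedBall hCc hx hr hcpt
  have hsal : (hC.recessionCone x).Salient := by
    intro v hv hv0 hnv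
    refine hv0 (hline v fun t => ?_)
    rcases le_total 0 t with ht | ht
    · exact hv t ht
    · simpa using hnv (-t) (neg_nonneg.2 ht)
  obtain ⟨f, hf⟩ := hsal.exists_dual_pos fun M => by
    refine ((hball M).image (f := fun y => y - x) (by fun_prop)).of_isClosed_subset
      ((hC.isClosed_recessionCone hCc x).inter Metric.isClosed_closedBall) ?_
    rintro v ⟨hv, hvM⟩
    exact ⟨x + v, ⟨by simpa using hv 1 zero_le_one, by simpa using hvM⟩, by simp⟩
  have hDconv : Convex ℝ (C ∩ {y | f y ≤ f x}) :=
    hC.inter (convex_halfSpace_le f.toLinearMap.isLinear _)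
  have hD : IsCompact (C ∩ {y | f y ≤ f x}) := by
    refine hDconv.isCompact_of_recessionCone
      (hCc.inter (isClosed_le f.continuous continuous_const)) ⟨hx, le_refl (f x)⟩ (fun M => ?_) ?_
    · rw [Set.inter_right_comm]
      exact (hball M).inter_right (isClosed_le f.continuous continuous_const)
    · intro v hv
      by_contra hv0
      have h1 : f (x + (1 : ℝ) • v) ≤ f x := (hv 1 zero_le_one).2
      have h2 := hf v (fun t ht => (hv t ht).1) hv0
      rw [one_smul, map_add] at h1
      linarith
  obtain ⟨m, hm, hmin⟩ := hD.exists_isMinOn ⟨x, hx, le_refl (f x)⟩ f.continuous.continuousOn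
  have hminC : ∀ y ∈ C, f m ≤ f y := fun y hy =>
    (le_total (f y) (f x)).elim (fun h => hmin ⟨hy, h⟩) fun h => hm.2.trans h
  -- Exposed faces are sets of maximisers, hence the sign of `-f`.
  have hexp : IsExposed ℝ C {y ∈ C | ∀ z ∈ C, (-f) z ≤ (-f) y} := fun _ => ⟨-f, rfl⟩
  have hface : IsCompact {y ∈ C | ∀ z ∈ C, (-f) z ≤ (-f) y} := by
    refine hD.of_isClosed_subset (hexp.isClosed hCc) fun y hy => ⟨hy.1, ?_⟩
    simpa using hy.2 x hx
  obtain ⟨e, he⟩ := hface.extremePoints_nonempty ⟨m, hm.1, fun z hz => by simpa using hminC z hz⟩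
  exact ⟨e, hexp.isExtreme.extremePoints_subset_extremePoints he⟩

theorem IsClosed.isCompact_inter_closedBall_of_finiteDimensional {C : Set E} (hCc : IsClosed C)
    [FiniteDimensional ℝ (vectorSpan ℝ C)] {x : E} (hx : x ∈ C) (r : ℝ) :
    IsCompact (C ∩ Metric.closedBall x r) := by
  have := FiniteDimensional.proper_real (vectorSpan ℝ C)
  refine ((isCompact_closedBall (0 : vectorSpan ℝ C) r).image
    (f := fun v : vectorSpan ℝ C => x + (v : E)) (by fun_prop)).of_isClosed_subset
    (hCc.inter Metric.isClosed_closedBall) ?_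
  rintro y ⟨hy, hyr⟩
  refine ⟨⟨y - x, vsub_mem_vectorSpan ℝ hy hx⟩, ?_, by simp⟩
  rw [mem_closedBall_zero_iff]
  exact mem_closedBall_iff_norm.1 hyr

end NormedSpace

/-! ### The set K + θ(0) for a q-compact K -/

namespace AsymmetricNorm

variable {X : Type*} [AddCommGroup X] [Module ℝ X] (q : AsymmetricNorm X)

theorem map_zero : q 0 = 0 := ((q.eq_zero_iff' 0).2 rfl).1

theorem isOpen_ball {x : X} {ε : ℝ} (hε : 0 < ε) : @IsOpen X q.topology (q.ball x ε) :=
  TopologicalSpace.isOpen_generateFrom_of_mem ⟨x, ε, hε, rfl⟩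

theorem ball_mem_nhds (x : X) {ε : ℝ} (hε : 0 < ε) : q.ball x ε ∈ @nhds X q.topology x :=
  @IsOpen.mem_nhds X q.topology x _ (q.isOpen_ball hε) (by simpa [ball, map_zero] using hε)

variable {q} {K : Set X}

theorem IsQCompact.exists_le (hK : q.IsQCompact K) : ∃ M, ∀ k ∈ K, q k ≤ M := by
  let := q.topology
  refine IsCompact.induction_on (p := fun s => ∃ M, ∀ k ∈ s, q k ≤ M) hK ⟨0, by simp⟩ ?_ ?_ ?_
  · rintro s t hst ⟨M, hM⟩
    exact ⟨M, fun k hk => hM k (hst hk)⟩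
  · rintro s t ⟨M, hM⟩ ⟨N, hN⟩
    refine ⟨max M N, ?_⟩
    rintro k (hk | hk)
    exacts [(hM k hk).trans (le_max_left _ _), (hN k hk).trans (le_max_right _ _)]
  · intro x _
    refine ⟨_, mem_nhdsWithin_of_mem_nhds (q.ball_mem_nhds x one_pos), q x + 1, fun k hk => ?_⟩
    have h := q.add_le' (k - x) x
    rw [sub_add_cancel] at h
    have h' : q (k - x) < 1 := hk
    linarith

/-- A point outside `K + θ(0)` has positive `q`-distance to the `q`-compact set `K`. -/
theorem IsQCompact.exists_pos_le (hK : q.IsQCompact K) {z : X} (hz : z ∉ K + q.thetaZero) :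
    ∃ δ > 0, ∀ k ∈ K, δ ≤ q (z - k) := by
  let := q.topology
  refine IsCompact.induction_on (p := fun s => ∃ δ > 0, ∀ k ∈ s, δ ≤ q (z - k)) hK
    ⟨1, one_pos, by simp⟩ ?_ ?_ ?_
  · rintro s t hst ⟨M, hM0, hM⟩
    exact ⟨M, hM0, fun k hk => hM k (hst hk)⟩
  · rintro s t ⟨M, hM0, hM⟩ ⟨N, hN0, hN⟩
    refine ⟨min M N, lt_min hM0 hN0, ?_⟩
    rintro k (hk | hk)
    exacts [(min_le_left _ _).trans (hM k hk), (min_le_right _ _).trans (hN k hk)]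
  · intro x hx
    have hpos : 0 < q (z - x) := (q.nonneg' _).lt_of_ne fun h =>
      hz ⟨x, hx, z - x, h.symm, add_sub_cancel x z⟩
    refine ⟨_, mem_nhdsWithin_of_mem_nhds (q.ball_mem_nhds x (half_pos hpos)),
      q (z - x) / 2, half_pos hpos, fun k hk => ?_⟩
    have h := q.add_le' (z - k) (k - x)
    rw [sub_add_sub_cancel] at h
    have h' : q (k - x) < q (z - x) / 2 := hk
    linarith

variable (q) in
theorem convex_thetaZero : Convex ℝ q.thetaZero := by
  intro x hx y hy a b ha hb _
  have hx : q x = 0 := hx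
  have hy : q y = 0 := hy
  have h := q.add_le' (a • x) (b • y)
  rw [q.smul' a x ha, q.smul' b y hb, hx, hy] at h
  exact le_antisymm (by simpa using h) (q.nonneg' _)

/-- Since q is bounded above on K + θ(0), both q(tv) and q(-tv) are bounded in t ≥ 0, and
homogeneity forces q(v) = q(-v) = 0. -/
theorem IsQCompact.eq_zero_of_line_subset (hK : q.IsQCompact K) {x v : X}
    (hv : ∀ t : ℝ, x + t • v ∈ K + q.thetaZero) : v = 0 := by
  obtain ⟨M, hM⟩ := hK.exists_le
  have hbd : ∀ t : ℝ, q (t • v) ≤ M + q (-x) := by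
    intro t
    obtain ⟨k, hk, w, hw, hkw⟩ := hv t
    have hkw : k + w = x + t • v := hkw
    have hw : q w = 0 := hw
    have h1 := q.add_le' k w
    have h2 := q.add_le' (k + w) (-x)
    rw [show k + w + -x = t • v by rw [hkw, add_neg_cancel_comm]] at h2
    linarith [hM k hk]
  have hzero : ∀ u : X, (∀ t : ℝ, 0 ≤ t → q (t • u) ≤ M + q (-x)) → q u = 0 := by
    intro u hu
    by_contra hne
    have hpos : 0 < q u := (q.nonneg' u).lt_of_ne' hne
    have hN : 0 ≤ M + q (-x) := (q.nonneg' _).trans (hu 0 le_rfl)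
    have h := hu ((M + q (-x) + 1) / q u) (by positivity)
    rw [q.smul' _ _ (by positivity), div_mul_cancel₀ _ hne] at h
    linarith
  refine (q.eq_zero_iff' v).1 ⟨hzero v fun t _ => hbd t, hzero (-v) fun t _ => ?_⟩
  rw [smul_neg, ← neg_smul]
  exact hbd (-t)

theorem extremePoints_add_thetaZero_subset :
    (K + q.thetaZero).extremePoints ℝ ⊆ K.extremePoints ℝ := by
  have hsub : K ⊆ K + q.thetaZero := fun k hk => ⟨k, hk, 0, q.map_zero, add_zero k⟩
  rintro _ ⟨⟨k, hk, w, hw, rfl⟩, hext⟩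
  have hw2 : (2 : ℝ) • w ∈ q.thetaZero := by
    have hw : q w = 0 := hw
    change q _ = 0
    rw [q.smul' _ _ zero_le_two, hw, mul_zero]
  have h : k = k + w := hext (hsub hk) ⟨k, hk, _, hw2, rfl⟩
    ⟨1 / 2, 1 / 2, by norm_num, by norm_num, by norm_num, by module⟩
  change k + w ∈ _
  rw [← h]
  refine ⟨hk, fun y hy z hz hyz => ?_⟩
  rw [h] at hyz ⊢
  exact hext (hsub hy) (hsub hz) hyz

variable (q)

/-- The norm `q^s`. -/
@[reducible]
def symmetrizationNorm : Norm X := ⟨q.symmetrization⟩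

theorem symmetrization_neg (x : X) : q.symmetrization (-x) = q.symmetrization x := by
  change max (q (-x)) (q (- -x)) = max (q x) (q (-x))
  rw [neg_neg, max_comm]

theorem le_symmetrization (x : X) : q x ≤ q.symmetrization x := le_max_left _ _

theorem symmetrization_core : @NormedSpace.Core ℝ X _ _ _ q.symmetrizationNorm :=
  let := q.symmetrizationNorm
  { norm_nonneg := q.symmetrization.nonneg'
    norm_smul := fun c x => by
      change q.symmetrization (c • x) = |c| * q.symmetrization x
      rcases le_total 0 c with hc | hc
      · rw [abs_of_nonneg hc, q.symmetrization.smul' c x hc]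
      · rw [abs_of_nonpos hc, ← q.symmetrization.smul' _ x (neg_nonneg.2 hc), neg_smul,
          symmetrization_neg]
    norm_triangle := q.symmetrization.add_le'
    norm_eq_zero_iff := fun x => by
      rw [← q.symmetrization.eq_zero_iff' x, q.symmetrization_neg, and_self]
      rfl }

/-- The normed group structure given by `q^s`. -/
@[reducible]
noncomputable def normedAddCommGroup : NormedAddCommGroup X :=
  @NormedAddCommGroup.ofCore ℝ X _ _ _ q.symmetrizationNorm q.symmetrization_core

/-- The normed space structure given by `q^s`. -/
@[reducible]
noncomputable def normedSpace : @NormedSpace ℝ X _ q.normedAddCommGroup.toSeminormedAddCommGroup :=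
  @NormedSpace.ofCore ℝ X _ q.normedAddCommGroup.toSeminormedAddCommGroup _ q.symmetrization_core

theorem symmetrization_topology_eq :
    q.symmetrization.topology =
      q.normedAddCommGroup.toMetricSpace.toUniformSpace.toTopologicalSpace := by
  let := q.normedAddCommGroup
  have hball : ∀ (x : X) (ε : ℝ), q.symmetrization.ball x ε = Metric.ball x ε := by
    intro x ε
    ext y
    rw [mem_ball_iff_norm]
    rfl
  apply le_antisymm
  · intro U hU
    refine (@isOpen_iff_forall_mem_open X q.symmetrization.topology U).2 fun x hx => ?_
    obtain ⟨ε, hε, hεU⟩ := Metric.isOpen_iff.1 hU x hx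
    exact ⟨q.symmetrization.ball x ε, hball x ε ▸ hεU, q.symmetrization.isOpen_ball hε,
      hball x ε ▸ Metric.mem_ball_self hε⟩
  · refine le_generateFrom ?_
    rintro _ ⟨x, ε, -, rfl⟩
    rw [hball]
    exact Metric.isOpen_ball

variable {q}

/-- Adding w ∈ θ(0) cannot bring a point of K closer to z: q(z - k) ≤ q(z - (k + w)). So a positive
q-distance from z to K persists for K + θ(0), and q ≤ q^s. -/
theorem IsQCompact.isClosed_add_thetaZero (hK : q.IsQCompact K) :
    @IsClosed X q.normedAddCommGroup.toMetricSpace.toUniformSpace.toTopologicalSpace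
      (K + q.thetaZero) := by
  let := q.normedAddCommGroup
  refine isClosed_of_closure_subset fun z hz => ?_
  by_contra hzC
  obtain ⟨δ, hδ, hle⟩ := hK.exists_pos_le hzC
  obtain ⟨_, ⟨k, hk, w, hw, rfl⟩, hdist⟩ := Metric.mem_closure_iff.1 hz δ hδ
  rw [dist_eq_norm] at hdist
  have hw : q w = 0 := hw
  have h1 : q (z - (k + w)) < δ := (q.le_symmetrization _).trans_lt hdist
  have h2 := q.add_le' (z - (k + w)) w
  rw [show z - (k + w) + w = z - k by abel] at h2
  linarith [hle k hk]

end AsymmetricNorm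

theorem theorem4p2 {X : Type*} [AddCommGroup X] [Module ℝ X] (q : AsymmetricNorm X)
    (K : Set X) (hne : K.Nonempty) (hconv : Convex ℝ K) (hcomp : q.IsQCompact K) :
    (q.symmetrization.IsQLocallyCompact (K + q.thetaZero) →
      (Set.extremePoints ℝ K).Nonempty) ∧
    (FiniteDimensional ℝ (vectorSpan ℝ (K + q.thetaZero)) →
      (Set.extremePoints ℝ K).Nonempty) := by
  let := q.normedAddCommGroup
  let := q.normedSpace
  obtain ⟨x, hxK⟩ := hne
  have hx : x ∈ K + q.thetaZero := ⟨x, hxK, 0, q.map_zero, add_zero x⟩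
  have hclosed : IsClosed (K + q.thetaZero) := hcomp.isClosed_add_thetaZero
  have hklee : ∀ r > 0, IsCompact ((K + q.thetaZero) ∩ Metric.closedBall x r) →
      (K.extremePoints ℝ).Nonempty := fun r hr hcpt =>
    ((hconv.add q.convex_thetaZero).extremePoints_nonempty_of_no_line hclosed hx hr hcpt
      fun v hv => hcomp.eq_zero_of_line_subset hv).mono
      AsymmetricNorm.extremePoints_add_thetaZero_subset
  constructor
  · intro hloc
    rw [AsymmetricNorm.IsQLocallyCompact, q.symmetrization_topology_eq] at hloc
    have hloc : LocallyCompactSpace ↥(K + q.thetaZero) := hloc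
    obtain ⟨s, hs, hsx⟩ := exists_compact_mem_nhds (⟨x, hx⟩ : ↥(K + q.thetaZero))
    obtain ⟨u, hu, hus⟩ := mem_nhds_subtype _ _ _ |>.1 hsx
    obtain ⟨r, hr, hru⟩ := Metric.nhds_basis_closedBall.mem_iff.1 hu
    refine hklee r hr ((hs.image continuous_subtype_val).of_isClosed_subset
      (hclosed.inter Metric.isClosed_closedBall) ?_)
    rintro y ⟨hy, hyr⟩
    exact ⟨⟨y, hy⟩, hus (hru hyr), rfl⟩
  · intro hfin
    exact hklee 1 one_pos (hclosed.isCompact_inter_closedBall_of_finiteDimensional hx 1)
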